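/- Let $R$ be a ring with identity, let $C$ be a pure-injective $R$-module which cogenerates the category of $R$-modules, and let $M$ be a $C$-stationary $R$-module (for example a strict $C$-stationary one). Here $M$ is $C$-stationary if it is the direct limit, with canonical maps $f_i\colon F_i\to M$, of a directed system $(F_i, f_{ji}\colon F_i\to F_j \mid i\le j\in I)$ of finitely presented modules such that for every $i\in I$ there is $j\ge i$ with $\operatorname{Im}\operatorname{Hom}_R(f_{ji},C)=\operatorname{Im}\operatorname{Hom}_R(f_{ki},C)$ for all $k\ge j$; it is strict $C$-stationary if the system and the $j$'s can be chosen so that, moreover, this image equals $\operatorname{Im}\operatorname{Hom}_R(f_i,C)$. Then there is an $\aleph_1$-dense system $\mathcal L$ of submodules of $M$, that is, a set $\mathcal L$ of countably presented submodules of $M$, closed under unions of nonempty well-ordered ascending chains of countable length, such that every countable subset of $M$ is contained in some member of $\mathcal L$, with the following properties. 1. Every $N\in\mathcal L$ is strict $C$-stationary (hence $C$-stationary). 2. For every submodule $N$ of $M$ that is the union of a nonempty directed family of members of $\mathcal L$, the restriction map $\operatorname{Hom}_R(M,C)\to\operatorname{Hom}_R(N,C)$ is surjective; consequently, if $\operatorname{Ext}^1_R(M,C)=0$,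 then $\operatorname{Ext}^1_R(M/N,C)=0$. -/

import Mathlib

universe u

/-! ### Purity, pure-injective modules -/

/-- An `R`-linear map `i : A → B` is a pure monomorphism: it is injective, and every finite system
of `R`-linear equations with right hand sides in `A` that is solvable in `B` is solvable in `A`. -/
def IsPureMono {R : Type u} [Ring R] {A B : Type u} [AddCommGroup A] [Module R A]
    [AddCommGroup B] [Module R B] (i : A →ₗ[R] B) : Prop :=
  Function.Injective i ∧
    ∀ (m n : ℕ) (r : Fin m → Fin n → R) (a : Fin m → A),
      (∃ b : Fin n → B, ∀ k, ∑ l, r k l • b l = i (a k)) →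
        ∃ a' : Fin n → A, ∀ k, ∑ l, r k l • a' l = a k

/-- `C` is pure-injective: every linear map to `C` extends along every pure monomorphism. -/
def IsPureInjective (R : Type u) [Ring R] (C : Type u) [AddCommGroup C] [Module R C] : Prop :=
  ∀ (A B : Type u) [AddCommGroup A] [Module R A] [AddCommGroup B] [Module R B]
    (i : A →ₗ[R] B), IsPureMono i → ∀ φ : A →ₗ[R] C, ∃ ψ : B →ₗ[R] C, ψ ∘ₗ i = φ

/-! ### Mittag-Leffler inverse systems and stationary modules -/

/-- The Mittag-Leffler condition for an inverse system `(H i, h : H j → H i)` over `ι`: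
for each `i` there is `j ≥ i` such that the images in `H i` of all `H k`, `k ≥ j`, coincide. -/
def IsMLInverseSystem {ι : Type*} [Preorder ι] {H : ι → Type*}
    (h : ∀ i j, i ≤ j → H j → H i) : Prop :=
  ∀ i, ∃ (j : ι) (hij : i ≤ j), ∀ (k : ι) (hjk : j ≤ k),
    Set.range (h i j hij) = Set.range (h i k (hij.trans hjk))

/-- The strict Mittag-Leffler condition for an inverse system with limit `L` and limit maps
`p i : L → H i`: the stable image is moreover the image of the limit map. -/
def IsStrictMLInverseSystem {ι : Type*} [Preorder ι] {H : ι → Type*}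
    (h : ∀ i j, i ≤ j → H j → H i) {L : Type*} (p : ∀ i, L → H i) : Prop :=
  ∀ i, ∃ (j : ι) (hij : i ≤ j),
    (∀ (k : ι) (hjk : j ≤ k), Set.range (h i j hij) = Set.range (h i k (hij.trans hjk))) ∧
      Set.range (h i j hij) = Set.range (p i)

/-- A directed presentation of `M` by finitely presented modules: a directed system
`(F i, f i j : F i → F j)` of finitely presented modules over a nonempty directed set, together
with maps `F i → M` that exhibit `M` as its direct limit. -/
structure DirectedFPPresentation (R : Type u) [Ring R] (M : Type u) [AddCommGroup M]
    [Module R M] where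
  /-- the index set -/
  ι : Type u
  [preorder : Preorder ι]
  [decEq : DecidableEq ι]
  [nonempty : Nonempty ι]
  [directed : IsDirectedOrder ι]
  /-- the modules of the system -/
  F : ι → Type u
  [addCommGroup : ∀ i, AddCommGroup (F i)]
  [module : ∀ i, Module R (F i)]
  finitePresentation : ∀ i, Module.FinitePresentation R (F i)
  /-- the transition maps -/
  f : ∀ i j, i ≤ j → F i →ₗ[R] F j
  directedSystem : DirectedSystem F (fun _ _ h => f _ _ h)
  /-- the canonical maps to the limit -/
  g : ∀ i, F i →ₗ[R] M
  compatible : ∀ i j (hij : i ≤ j) (x : F i), g j (f i j hij x) = g i x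
  bijective_lift : Function.Bijective (Module.DirectLimit.lift R ι F f g compatible)

attribute [instance] DirectedFPPresentation.preorder DirectedFPPresentation.decEq
  DirectedFPPresentation.nonempty DirectedFPPresentation.directed
  DirectedFPPresentation.addCommGroup DirectedFPPresentation.module

/-- `M` is `B`-stationary: it has a directed presentation by finitely presented modules from which
`Hom(_, B)` induces a Mittag-Leffler inverse system. -/
def IsStationaryModule (R : Type u) [Ring R] (B M : Type u) [AddCommGroup B] [Module R B]
    [AddCommGroup M] [Module R M] : Prop :=
  ∃ P : DirectedFPPresentation R M,
    IsMLInverseSystem (H := fun i => P.F i →ₗ[R] B) (fun i j hij φ => φ ∘ₗ P.f i j hij)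

/-- `M` is strict `B`-stationary: it has a directed presentation by finitely presented modules from
which `Hom(_, B)` induces a strict Mittag-Leffler inverse system; its limit is `Hom(M, B)`, with the
restrictions along the canonical maps `F i → M` as limit maps. -/
def IsStrictStationaryModule (R : Type u) [Ring R] (B M : Type u) [AddCommGroup B] [Module R B]
    [AddCommGroup M] [Module R M] : Prop :=
  ∃ P : DirectedFPPresentation R M,
    IsStrictMLInverseSystem (H := fun i => P.F i →ₗ[R] B) (fun i j hij φ => φ ∘ₗ P.f i j hij)
      (L := M →ₗ[R] B) (fun i φ => φ ∘ₗ P.g i)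

/-! ### Dense systems -/

/-- `N` is `(< κ)`-presented: it has a generating set `S` of cardinality `< κ` whose module of
relations is generated by fewer than `κ` elements. -/
def IsLTPresented (R : Type u) [Ring R] (κ : Cardinal.{u}) (N : Type u) [AddCommGroup N]
    [Module R N] : Prop :=
  ∃ S : Set N, Cardinal.mk S < κ ∧ Submodule.span R S = ⊤ ∧
    ∃ T : Set (S →₀ R), Cardinal.mk T < κ ∧
      Submodule.span R T = LinearMap.ker (Finsupp.linearCombination R ((↑) : S → N))

/-- `𝓢` is a `κ`-dense system of submodules of `M` (`κ` an infinite regular cardinal): its members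
are `(< κ)`-presented, it is closed under unions of nonempty well-ordered ascending chains of length
`< κ`, and every subset of `M` of cardinality `< κ` is contained in a member. -/
structure IsDenseSystem (R : Type u) [Ring R] (κ : Cardinal.{u}) (M : Type u) [AddCommGroup M]
    [Module R M] (𝓢 : Set (Submodule R M)) : Prop where
  presented : ∀ N ∈ 𝓢, IsLTPresented R κ N
  iSup_mem : ∀ o : Ordinal.{u}, 0 < o → o < κ.ord → ∀ N : Set.Iio o → Submodule R M,
    Monotone N → (∀ i, N i ∈ 𝓢) → (⨆ i, N i) ∈ 𝓢
  exists_subset : ∀ X : Set M, Cardinal.mk X < κ → ∃ N ∈ 𝓢, X ⊆ N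

/-! The proof replaces stationarity by a finitary condition relative to a map,
`IsStrictStationaryAlong C u`, in which the functions to `C` being tested need not be linear. The
condition is local, so it passes to directed unions, and it is governed by finite sets of relations,
so a countable closure argument can reach it.

Pure-injectivity enters through pushouts: a map to `C` extends once the relevant finite systems are
solvable in `C`. For a stationary `M`, the Mittag-Leffler property supplies these solutions, so `M`
is strict stationary along the identity. For any `N`, strict stationarity along `u : N → M` lets
every map `N → C` extend to `M`.

Now choose for each finite `F ⊆ M` a finite set `σ F` of relations as in the condition, and close a
countable set under adding the supports of the `σ F`. The span of the resulting `Y` is strict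
stationary along its inclusion. Since `C` cogenerates, every relation with support `F` lies in the
span of `σ F`; so countably many relations present the span of `Y`. The dense system consists of all
countably presented submodules that are strict stationary along their inclusion into `M`. -/

/-- A linear map `φ : N → C` to a pure-injective module extends along `u : N → M` as soon as the
finite systems of linear equations that `u` makes solvable in `M` become solvable in `C`. -/
theorem IsPureInjective.exists_extension {R : Type u} [Ring R] {C N M : Type u}
    [AddCommGroup C] [Module R C] [AddCommGroup N] [Module R N] [AddCommGroup M] [Module R M]
    (hC : IsPureInjective R C) (u : N →ₗ[R] M) (φ : N →ₗ[R] C)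
    (h : ∀ (m n : ℕ) (r : Fin m → Fin n → R) (a : Fin m → N),
      (∃ b : Fin n → M, ∀ k, ∑ l, r k l • b l = u (a k)) →
        ∃ c : Fin n → C, ∀ k, ∑ l, r k l • c l = φ (a k)) :
    ∃ ψ : M →ₗ[R] C, ψ ∘ₗ u = φ := by
  let D : Submodule R (C × M) := LinearMap.range (φ.prod (-u))
  have hpure : IsPureMono (D.mkQ ∘ₗ LinearMap.inl R C M) := by
    refine ⟨?_, fun m n r a ⟨b, hb⟩ => ?_⟩
    · rw [injective_iff_map_eq_zero]
      intro c hc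
      obtain ⟨x, hx⟩ := (Submodule.Quotient.mk_eq_zero D).1 hc
      have h1 : φ x = c := congrArg Prod.fst hx
      have h2 : -u x = 0 := congrArg Prod.snd hx
      -- One equation in no unknowns: it says that `u x = 0` forces `φ x = 0`.
      obtain ⟨_, h3⟩ := h 1 0 (fun _ => Fin.elim0) (fun _ => x)
        ⟨Fin.elim0, fun _ => by simpa using (neg_eq_zero.1 h2).symm⟩
      rw [← h1, ← h3 0]
      simp
    · choose d hd using fun l => D.mkQ_surjective (b l)
      have key : ∀ k, ∃ x : N, (φ.prod (-u)) x = ∑ l, r k l • d l - (a k, 0) := fun k => by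
        refine (Submodule.Quotient.mk_eq_zero D).1 ?_
        rw [← Submodule.mkQ_apply, map_sub, map_sum, sub_eq_zero]
        simpa [hd] using hb k
      choose x hx using key
      have h1 : ∀ k, φ (x k) = ∑ l, r k l • (d l).1 - a k := fun k => by
        simpa [Prod.fst_sum] using congrArg Prod.fst (hx k)
      have h2 : ∀ k, -u (x k) = ∑ l, r k l • (d l).2 := fun k => by
        simpa [Prod.snd_sum] using congrArg Prod.snd (hx k)
      -- The lifts `d l` solve the system up to the errors `x k`. Their `M`-components solve it with
      -- right hand sides `u (-x k)`, so `C` contains a solution for `φ (-x k)`, which corrects the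
      -- `C`-components.
      obtain ⟨c, hc⟩ := h m n r (fun k => -x k)
        ⟨fun l => (d l).2, fun k => by rw [map_neg, h2]⟩
      refine ⟨fun l => (d l).1 + c l, fun k => ?_⟩
      simp only [smul_add, Finset.sum_add_distrib, hc, map_neg, h1]
      abel
  obtain ⟨ρ, hρ⟩ := hC _ _ _ hpure LinearMap.id
  refine ⟨ρ ∘ₗ D.mkQ ∘ₗ LinearMap.inr R C M, LinearMap.ext fun x => ?_⟩
  have hx : D.mkQ (0, u x) = D.mkQ (φ x, 0) := by
    refine (Submodule.Quotient.eq D).2 ⟨-x, ?_⟩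
    simp
  have := LinearMap.congr_fun hρ (φ x)
  simp only [LinearMap.comp_apply, LinearMap.inl_apply, LinearMap.inr_apply, LinearMap.id_apply]
    at this ⊢
  rw [hx, this]

/-! ### Strict stationarity along a map -/

section
variable {R : Type u} [Ring R] (C : Type u) {N M : Type u} [AddCommGroup C] [Module R C]
  [AddCommGroup N] [Module R N] [AddCommGroup M] [Module R M]

/-- Every finite subset `X` of `N` satisfies finitely many linear relations, among elements of `N`,
such that each function to `C` that respects these relations agrees on `X` with a homomorphism
`M → C` composed with `u`. -/
def IsStrictStationaryAlong (u : N →ₗ[R] M) : Prop :=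
  ∀ X : Finset N, ∃ S : Finset (N →₀ R), (∀ s ∈ S, Finsupp.linearCombination R id s = 0) ∧
    ∀ c : N → C, (∀ s ∈ S, Finsupp.linearCombination R c s = 0) →
      ∃ ψ : M →ₗ[R] C, ∀ x ∈ X, ψ (u x) = c x

variable {C}

theorem linearCombination_id_mapDomain {Y : Type u} (f : Y → M) (s : Y →₀ R) :
    Finsupp.linearCombination R id (s.mapDomain f) = Finsupp.linearCombination R f s := by
  rw [Finsupp.linearCombination_mapDomain]; rfl

theorem linearCombination_linearMap (φ : N →ₗ[R] M) (s : N →₀ R) :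
    Finsupp.linearCombination R φ s = φ (Finsupp.linearCombination R id s) := by
  rw [Finsupp.apply_linearCombination]; rfl

/-- A linear map to `C` from the span of a family of elements that respects the relations in a
finite set of generating relations. -/
theorem exists_linearMap_of_relations {α : Type u} {v : α → N}
    (hv : Submodule.span R (Set.range v) = ⊤)
    {T : Set (α →₀ R)} (hT : LinearMap.ker (Finsupp.linearCombination R v) ≤ Submodule.span R T)
    (c : α → C) (hc : ∀ t ∈ T, Finsupp.linearCombination R c t = 0) :
    ∃ φ : N →ₗ[R] C, ∀ a, φ (v a) = c a := by
  have hsurj : Function.Surjective (Finsupp.linearCombination R v) := by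
    rw [← LinearMap.range_eq_top, Finsupp.range_linearCombination, hv]
  have hker : LinearMap.ker (Finsupp.linearCombination R v) ≤
      LinearMap.ker (Finsupp.linearCombination R c) :=
    hT.trans (Submodule.span_le.2 hc)
  let e := LinearMap.quotKerEquivOfSurjective _ hsurj
  refine ⟨(Submodule.liftQ _ (Finsupp.linearCombination R c) hker) ∘ₗ e.symm.toLinearMap,
    fun a => ?_⟩
  have : e.symm (v a) = Submodule.Quotient.mk (Finsupp.single a 1) := by
    rw [LinearEquiv.symm_apply_eq]
    simp [e]
  simp [this]

/-- Finitely presented modules are strict stationary along the identity. -/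
theorem IsStrictStationaryAlong.of_finitePresentation [Module.FinitePresentation R N] :
    IsStrictStationaryAlong C (LinearMap.id : N →ₗ[R] N) := by
  classical
  intro X
  obtain ⟨G, hG, T, hT⟩ := Module.FinitePresentation.out (R := R) (M := N)
  have hG' : Submodule.span R (Set.range ((↑) : G → N)) = ⊤ := by simpa using hG
  have hsurj : Function.Surjective (Finsupp.linearCombination R ((↑) : G → N)) := by
    rw [← LinearMap.range_eq_top, Finsupp.range_linearCombination, hG']
  choose a ha using hsurj
  -- The defining relations make `c` linear on the generators; the others express each `x ∈ X`
  -- through the generators.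
  refine ⟨T.image (Finsupp.mapDomain (↑)) ∪
    X.image (fun x => Finsupp.single x 1 - (a x).mapDomain (↑)), ?_, fun c hc => ?_⟩
  · intro s hs
    rcases Finset.mem_union.1 hs with hs | hs <;> obtain ⟨t, ht, rfl⟩ := Finset.mem_image.1 hs
    · rw [linearCombination_id_mapDomain]
      exact hT.le (Submodule.subset_span ht)
    · simp [ha]
  · obtain ⟨φ, hφ⟩ := exists_linearMap_of_relations hG' hT.ge (fun g => c g) fun t ht => by
      have := hc _ (Finset.mem_union_left _ (Finset.mem_image_of_mem _ ht))
      rwa [Finsupp.linearCombination_mapDomain] at this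
    refine ⟨φ, fun x hx => ?_⟩
    have := hc _ (Finset.mem_union_right _ (Finset.mem_image_of_mem _ hx))
    rw [map_sub, Finsupp.linearCombination_mapDomain, Finsupp.linearCombination_single, one_smul,
      sub_eq_zero] at this
    have h2 := congrArg φ (ha x)
    rw [Finsupp.apply_linearCombination] at h2
    rw [LinearMap.id_apply, ← h2, this]
    congr 2
    exact funext hφ

/-- Strict stationarity along `u` lets all homomorphisms to a pure-injective module extend. -/
theorem IsStrictStationaryAlong.exists_extension (hC : IsPureInjective R C) {u : N →ₗ[R] M}
    (hu : IsStrictStationaryAlong C u) (φ : N →ₗ[R] C) : ∃ ψ : M →ₗ[R] C, ψ ∘ₗ u = φ := by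
  classical
  refine hC.exists_extension u φ fun m n r a ⟨b, hb⟩ => ?_
  obtain ⟨S, hS, h⟩ := hu (Finset.univ.image a)
  obtain ⟨ψ, hψ⟩ := h φ fun s hs => by rw [linearCombination_linearMap, hS s hs, map_zero]
  refine ⟨fun l => ψ (b l), fun k => ?_⟩
  rw [← hψ (a k) (Finset.mem_image_of_mem _ (Finset.mem_univ k)), ← hb k, map_sum]
  simp

namespace DirectedFPPresentation
variable (P : DirectedFPPresentation R M)

theorem exists_preimage (X : Finset M) : ∃ (i : P.ι), ∀ x ∈ X, ∃ y, P.g i y = x := by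
  have h1 : ∀ x : M, ∃ i y, P.g i y = x := fun x => by
    obtain ⟨z, rfl⟩ := P.bijective_lift.2 x
    obtain ⟨i, y, rfl⟩ := Module.DirectLimit.exists_of z
    exact ⟨i, y, by simp⟩
  choose i y h using h1
  obtain ⟨j, hj⟩ := (X.image i).exists_le
  refine ⟨j, fun x hx => ⟨P.f (i x) j (hj _ (Finset.mem_image_of_mem _ hx)) (y x), ?_⟩⟩
  rw [P.compatible, h]

theorem f_comp_f {i j k : P.ι} (hij : i ≤ j) (hjk : j ≤ k) (x : P.F i) :
    P.f j k hjk (P.f i j hij x) = P.f i k (hij.trans hjk) x :=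
  P.directedSystem.map_map hij hjk x

theorem exists_f_eq_zero {i : P.ι} {x : P.F i} (hx : P.g i x = 0) :
    ∃ (j : P.ι) (hij : i ≤ j), P.f i j hij x = 0 := by
  have := P.directedSystem
  refine Module.DirectLimit.of.zero_exact (f := P.f) (P.bijective_lift.1 ?_)
  simpa using hx

theorem exists_f_eq_zero_of_finite {α : Type} [Fintype α] {i : P.ι} (x : α → P.F i)
    (hx : ∀ a, P.g i (x a) = 0) : ∃ (j : P.ι) (hij : i ≤ j), ∀ a, P.f i j hij (x a) = 0 := by
  classical
  choose j hij h using fun a => P.exists_f_eq_zero (hx a)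
  obtain ⟨k, hk⟩ := (Finset.univ.image j).exists_le
  obtain ⟨l, hil, hkl⟩ := exists_ge_ge i k
  refine ⟨l, hil, fun a => ?_⟩
  rw [← P.f_comp_f (hij a) ((hk _ (Finset.mem_image_of_mem _ (Finset.mem_univ a))).trans hkl), h,
    map_zero]

end DirectedFPPresentation

/-- Stationary modules with respect to a pure-injective module are strict stationary. -/
theorem IsStationaryModule.isStrictStationaryAlong (hC : IsPureInjective R C)
    (hM : IsStationaryModule R C M) : IsStrictStationaryAlong C (LinearMap.id : M →ₗ[R] M) := by
  classical
  obtain ⟨P, hP⟩ := hM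
  intro X
  obtain ⟨i, hi⟩ := P.exists_preimage X
  choose! y hy using hi
  -- `j`, and hence `S`, depends only on `X`; only the later `φ` depends on `c`.
  obtain ⟨j, hij, hj⟩ := hP i
  have := P.finitePresentation j
  obtain ⟨S, hS, h⟩ := IsStrictStationaryAlong.of_finitePresentation (C := C) (R := R)
    (N := P.F j) (X.image fun x => P.f i j hij (y x))
  refine ⟨S.image (Finsupp.mapDomain (P.g j)), fun s hs => ?_, fun c hc => ?_⟩
  · obtain ⟨t, ht, rfl⟩ := Finset.mem_image.1 hs
    rw [linearCombination_id_mapDomain, linearCombination_linearMap, hS t ht, map_zero]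
  obtain ⟨φ, hφ⟩ := h (c ∘ P.g j) fun s hs => by
    have := hc _ (Finset.mem_image_of_mem _ hs)
    rwa [Finsupp.linearCombination_mapDomain] at this
  -- A solution in `M` already exists at some stage `k'` of the system. By the Mittag-Leffler
  -- property `φ ∘ f_ij` factors through `F k'`, and this factor `θ` carries the solution to `C`.
  obtain ⟨ψ, hψ⟩ := hC.exists_extension (P.g i) (φ ∘ₗ P.f i j hij) fun m n r a ⟨b, hb⟩ => by
    obtain ⟨k₀, hk₀⟩ := P.exists_preimage (Finset.univ.image b)
    obtain ⟨k, hjk, hkk⟩ := exists_ge_ge j k₀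
    have hb' : ∀ l, ∃ z, P.g k z = b l := fun l => by
      obtain ⟨z, hz⟩ := hk₀ (b l) (Finset.mem_image_of_mem _ (Finset.mem_univ l))
      exact ⟨P.f _ _ hkk z, by rw [P.compatible, hz]⟩
    choose z hz using hb'
    obtain ⟨k', hk', hz'⟩ := P.exists_f_eq_zero_of_finite
      (fun t => ∑ l, r t l • z l - P.f i k (hij.trans hjk) (a t)) fun t => by
        simp [P.compatible, hz, hb]
    obtain ⟨θ, hθ⟩ := (hj k' (hjk.trans hk')).le ⟨φ, rfl⟩
    refine ⟨fun l => θ (P.f k k' hk' (z l)), fun t => ?_⟩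
    have h1 := congrArg θ (hz' t)
    rw [map_sub, P.f_comp_f, map_sub, map_zero, sub_eq_zero] at h1
    refine Eq.trans ?_ (h1.trans (LinearMap.congr_fun hθ (a t)))
    simp
  refine ⟨ψ, fun x hx => ?_⟩
  have h1 := LinearMap.congr_fun hψ (y x)
  simp only [LinearMap.comp_apply, hy x hx] at h1
  rw [LinearMap.id_apply, h1]
  have h2 := hφ _ (Finset.mem_image_of_mem _ hx)
  simpa [P.compatible, hy x hx] using h2
end

/-! ### The canonical presentation by finite sets of elements and relations -/

section
variable {R : Type u} [Ring R] {C N M : Type u} [AddCommGroup C] [Module R C]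
  [AddCommGroup N] [Module R N] [AddCommGroup M] [Module R M]

namespace FiniteRelations
variable (R N)

/-- A finite set of elements of `N` with a finite set of linear relations between them. -/
abbrev Index : Type u :=
  {p : Finset N × Finset (N →₀ R) //
    ∀ s ∈ p.2, Finsupp.linearCombination R id s = 0 ∧ s ∈ Finsupp.supported R R (p.1 : Set N)}

variable {R N}

/-- The free module on the elements of an index. -/
abbrev Free (p : Index R N) : Type u := p.1.1 →₀ R

/-- The embedding of the free module of an index into the free module on `N`. -/
noncomputable abbrev incl (p : Index R N) : Free p →ₗ[R] (N →₀ R) :=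
  Finsupp.lmapDomain R R Subtype.val

theorem incl_injective (p : Index R N) : Function.Injective (incl p) :=
  Finsupp.mapDomain_injective Subtype.val_injective

theorem range_incl (p : Index R N) :
    LinearMap.range (incl p) = Finsupp.supported R R (p.1.1 : Set N) := by
  rw [LinearMap.range_eq_map, ← Finsupp.supported_univ, Finsupp.lmapDomain_supported]
  simp

/-- The map between free modules induced by an inclusion of indices. -/
noncomputable abbrev freeMap {p q : Index R N} (h : p ≤ q) : Free p →ₗ[R] Free q :=
  Finsupp.lmapDomain R R fun x => ⟨x.1, h.1 x.2⟩

theorem incl_freeMap {p q : Index R N} (h : p ≤ q) (x : Free p) :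
    incl q (freeMap h x) = incl p x :=
  Finsupp.mapDomain_comp.symm

/-- The relations of an index. -/
noncomputable abbrev relations (p : Index R N) : Submodule R (Free p) :=
  (Submodule.span R (p.1.2 : Set (N →₀ R))).comap (incl p)

theorem span_le_range (p : Index R N) :
    Submodule.span R (p.1.2 : Set (N →₀ R)) ≤ LinearMap.range (incl p) :=
  Submodule.span_le.2 fun s hs => by rw [range_incl]; exact (p.2 s hs).2

theorem span_le_ker (p : Index R N) : Submodule.span R (p.1.2 : Set (N →₀ R)) ≤
    LinearMap.ker (Finsupp.linearCombination R (id : N → N)) :=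
  Submodule.span_le.2 fun s hs => (p.2 s hs).1

theorem relations_le {p q : Index R N} (h : p ≤ q) :
    relations p ≤ (relations q).comap (freeMap h) := fun x hx => by
  rw [Submodule.mem_comap, Submodule.mem_comap, incl_freeMap]
  exact Submodule.span_mono (Finset.coe_subset.2 h.2) hx

/-- The module presented by an index. -/
noncomputable abbrev Presented (p : Index R N) : Type u := Free p ⧸ relations p

/-- The transition maps between presented modules. -/
noncomputable abbrev transition (p q : Index R N) (h : p ≤ q) : Presented p →ₗ[R] Presented q :=
  Submodule.mapQ _ _ (freeMap h) (relations_le h)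

/-- The canonical map from a presented module to `N`. -/
noncomputable abbrev toLimit (p : Index R N) : Presented p →ₗ[R] N :=
  Submodule.liftQ _ (Finsupp.linearCombination R (id : N → N) ∘ₗ incl p)
    fun _ hx => span_le_ker p hx

theorem toLimit_mkQ (p : Index R N) (x : Free p) : toLimit p ((relations p).mkQ x) =
    Finsupp.linearCombination R (id : N → N) (incl p x) := rfl

theorem transition_mkQ {p q : Index R N} (h : p ≤ q) (x : Free p) :
    transition p q h ((relations p).mkQ x) = (relations q).mkQ (freeMap h x) := rfl

theorem finitePresentation (p : Index R N) : Module.FinitePresentation R (Presented p) := by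
  refine Module.finitePresentation_of_free_of_surjective (relations p).mkQ
    (Submodule.mkQ_surjective _) ?_
  rw [Submodule.ker_mkQ]
  refine Submodule.fg_of_fg_map_injective (incl p) (incl_injective p) ?_
  rw [Submodule.map_comap_eq, inf_eq_right.2 (span_le_range p)]
  exact ⟨p.1.2, rfl⟩

/-- Adding the supports of the new relations to the elements keeps the pair an index. -/
theorem exists_ge (p : Index R N) (X : Finset N) (S : Finset (N →₀ R))
    (hS : ∀ s ∈ S, Finsupp.linearCombination R id s = 0) :
    ∃ q : Index R N, p ≤ q ∧ X ⊆ q.1.1 ∧ S ⊆ q.1.2 := by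
  classical
  refine ⟨⟨(p.1.1 ∪ (X ∪ S.biUnion Finsupp.support), p.1.2 ∪ S), fun s hs => ?_⟩,
    ⟨Finset.subset_union_left, Finset.subset_union_left⟩,
    Finset.subset_union_left.trans Finset.subset_union_right, Finset.subset_union_right⟩
  rcases Finset.mem_union.1 hs with h | h
  · exact ⟨(p.2 s h).1, Finsupp.supported_mono (Finset.coe_subset.2 Finset.subset_union_left)
      (p.2 s h).2⟩
  · refine ⟨hS s h, (Finsupp.mem_supported R s).2 (Finset.coe_subset.2 ?_)⟩
    exact ((Finset.subset_biUnion_of_mem Finsupp.support h).trans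
      Finset.subset_union_right).trans Finset.subset_union_right

instance : Nonempty (Index R N) := ⟨⟨(∅, ∅), by simp⟩⟩

instance : IsDirectedOrder (Index R N) := ⟨fun p q => by
  obtain ⟨r, h, hX, hS⟩ := exists_ge p q.1.1 q.1.2 fun s hs => (q.2 s hs).1
  exact ⟨r, h, hX, hS⟩⟩

theorem transition_self (p : Index R N) (x : Presented p) : transition p p le_rfl x = x := by
  obtain ⟨x, rfl⟩ := Submodule.mkQ_surjective _ x
  rw [transition_mkQ]
  congr 1
  exact Finsupp.mapDomain_id

theorem transition_transition {p q r : Index R N} (h : p ≤ q) (h' : q ≤ r) (x : Presented p) :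
    transition q r h' (transition p q h x) = transition p r (h.trans h') x := by
  obtain ⟨x, rfl⟩ := Submodule.mkQ_surjective _ x
  rw [transition_mkQ, transition_mkQ, transition_mkQ]
  congr 1
  exact Finsupp.mapDomain_comp.symm

theorem directedSystem :
    DirectedSystem (fun p : Index R N => Presented p) (fun _ _ h => transition _ _ h) where
  map_self p x := transition_self p x
  map_map _ _ _ h h' x := transition_transition h h' x

theorem toLimit_transition (p q : Index R N) (h : p ≤ q) (x : Presented p) :
    toLimit q (transition p q h x) = toLimit p x := by
  obtain ⟨x, rfl⟩ := Submodule.mkQ_surjective _ x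
  exact congrArg (Finsupp.linearCombination R (id : N → N)) (incl_freeMap h x)

/-- A difference that vanishes in `N` is itself a relation, so it dies at any index containing that
relation. -/
theorem bijective_lift [DecidableEq (Index R N)] : Function.Bijective
    (Module.DirectLimit.lift R (Index R N) Presented transition toLimit toLimit_transition) := by
  constructor
  · intro z w hzw
    obtain ⟨p, x, y, rfl, rfl⟩ := Module.DirectLimit.exists_of₂ z w
    obtain ⟨x, rfl⟩ := Submodule.mkQ_surjective _ x
    obtain ⟨y, rfl⟩ := Submodule.mkQ_surjective _ y
    rw [Module.DirectLimit.lift_of, Module.DirectLimit.lift_of, ← sub_eq_zero, ← map_sub,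
      ← map_sub, toLimit_mkQ] at hzw
    obtain ⟨q, h, -, hS⟩ := exists_ge p ∅ {incl p (x - y)}
      (by simpa only [Finset.mem_singleton, forall_eq] using hzw)
    rw [← Module.DirectLimit.of_f (hij := h), ← Module.DirectLimit.of_f (hij := h)]
    congr 1
    rw [← sub_eq_zero, ← map_sub, ← map_sub]
    refine (Submodule.Quotient.mk_eq_zero _).2 ?_
    rw [Submodule.mem_comap, incl_freeMap]
    exact Submodule.subset_span (hS (Finset.mem_singleton_self _))
  · intro x
    let p : Index R N := ⟨({x}, ∅), by simp⟩
    refine ⟨Module.DirectLimit.of R _ _ _ p ((relations p).mkQ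
      (Finsupp.single ⟨x, by simp [p]⟩ 1)), ?_⟩
    rw [Module.DirectLimit.lift_of, toLimit_mkQ]
    simp

variable (R N) in
/-- Every module is the directed limit of the modules presented by finitely many of its elements
and finitely many of their relations. -/
noncomputable def directedFPPresentation : DirectedFPPresentation R N where
  ι := Index R N
  decEq := Classical.decEq _
  F := Presented
  finitePresentation := finitePresentation
  f := transition
  directedSystem := directedSystem
  g := toLimit
  compatible := toLimit_transition
  bijective_lift := letI := Classical.decEq (Index R N); bijective_lift

end FiniteRelations

-- Once `q` contains the relations attached to the elements of `p`, every map from the module of `q`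
-- to `C` respects them. Its restriction to the module of `p` is therefore induced by a map `M → C`,
-- so it factors through `N`. The other inclusions of images are formal.
open FiniteRelations in
theorem IsStrictStationaryAlong.isStrictStationaryModule {u : N →ₗ[R] M}
    (hu : IsStrictStationaryAlong C u) : IsStrictStationaryModule R C N := by
  suffices key : IsStrictMLInverseSystem (ι := Index R N) (H := fun p => Presented p →ₗ[R] C)
      (fun p q h φ => φ ∘ₗ transition p q h) (L := N →ₗ[R] C) (fun p φ => φ ∘ₗ toLimit p) from
    ⟨directedFPPresentation R N, key⟩
  intro p
  obtain ⟨S, hS, h⟩ := hu p.1.1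
  obtain ⟨q, hpq, -, hSq⟩ := exists_ge p ∅ S hS
  have hfac : ∀ φ : Presented q →ₗ[R] C,
      ∃ ψ : N →ₗ[R] C, ψ ∘ₗ toLimit p = φ ∘ₗ transition p q hpq := fun φ => by
    -- `φ` extended to the free module on `N`, with value zero on the basis elements outside `q`.
    let Φ : (N →₀ R) →ₗ[R] C :=
      φ ∘ₗ (relations q).mkQ ∘ₗ Finsupp.lcomapDomain Subtype.val Subtype.val_injective
    have hΦ : ∀ x, Φ (incl q x) = φ ((relations q).mkQ x) := fun x =>
      congrArg (fun z => φ ((relations q).mkQ z))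
        (Finsupp.leftInverse_lcomapDomain_mapDomain (R := R) _ Subtype.val_injective x)
    have hlin : Finsupp.linearCombination R (fun x : N => Φ (Finsupp.single x 1)) = Φ := by
      ext x
      simp
    obtain ⟨ψ, hψ⟩ := h (fun x => Φ (Finsupp.single x 1)) fun s hs => by
      obtain ⟨t, rfl⟩ := span_le_range q (Submodule.subset_span (hSq hs))
      rw [hlin, hΦ, show (relations q).mkQ t = 0 from
        (Submodule.Quotient.mk_eq_zero _).2 (Submodule.subset_span (hSq hs)), map_zero]
    refine ⟨ψ ∘ₗ u, LinearMap.ext fun z => ?_⟩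
    obtain ⟨x, rfl⟩ := Submodule.mkQ_surjective _ z
    rw [LinearMap.comp_apply, LinearMap.comp_apply, LinearMap.comp_apply, transition_mkQ,
      ← hΦ, incl_freeMap,
      toLimit_mkQ, ← hlin, Finsupp.apply_linearCombination, Finsupp.apply_linearCombination]
    simp only [Finsupp.lmapDomain_apply, Finsupp.linearCombination_mapDomain]
    congr 2
    exact funext fun y : p.1.1 => hψ y.1 y.2
  have hle : ∀ k (hqk : q ≤ k), Set.range (fun φ : Presented q →ₗ[R] C =>
      φ ∘ₗ transition p q hpq) ⊆
      Set.range (fun φ : Presented k →ₗ[R] C => φ ∘ₗ transition p k (hpq.trans hqk)) := by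
    rintro k hqk _ ⟨φ, rfl⟩
    obtain ⟨ψ, hψ⟩ := hfac φ
    exact ⟨ψ ∘ₗ toLimit k, (LinearMap.ext fun z : Presented p =>
      congrArg ψ (toLimit_transition p k (hpq.trans hqk) z)).trans hψ⟩
  refine ⟨q, hpq, fun k hqk => (hle k hqk).antisymm ?_, Set.Subset.antisymm ?_ ?_⟩
  · rintro _ ⟨φ, rfl⟩
    exact ⟨φ ∘ₗ transition q k hqk, LinearMap.ext fun z =>
      congrArg φ (transition_transition hpq hqk z)⟩
  · rintro _ ⟨φ, rfl⟩
    exact hfac φ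
  · rintro _ ⟨ψ, rfl⟩
    exact ⟨ψ ∘ₗ toLimit q, LinearMap.ext fun z => congrArg ψ (toLimit_transition p q hpq z)⟩
end

/-! ### Countable closures -/

theorem Cardinal.mk_lt_aleph_one_iff {α : Type u} {S : Set α} :
    Cardinal.mk S < Cardinal.aleph 1 ↔ S.Countable := by
  rw [← Cardinal.le_aleph0_iff_set_countable, ← Cardinal.succ_aleph0, Order.lt_succ_iff]

theorem countable_setOf_finset_subset {α : Type*} {Y : Set α} (hY : Y.Countable) :
    {F : Finset α | (F : Set α) ⊆ Y}.Countable :=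
  Set.MapsTo.countable_of_injOn (f := fun F : Finset α => (F : Set α))
    (t := {S : Set α | S.Finite ∧ S ⊆ Y}) (fun F hF => ⟨F.finite_toSet, hF⟩)
    Finset.coe_injective.injOn (Set.countable_ofPred_finite_subset hY)

/-- Every countable set is contained in a countable set that is closed under a given map from finite
sets to finite sets. -/
theorem Set.Countable.exists_closed_superset {α : Type*} {X : Set α} (hX : X.Countable)
    (f : Finset α → Finset α) :
    ∃ Y : Set α, X ⊆ Y ∧ Y.Countable ∧ ∀ F : Finset α, (F : Set α) ⊆ Y → (f F : Set α) ⊆ Y := by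
  let step : Set α → Set α := fun Z => Z ∪ ⋃ F ∈ {F : Finset α | (F : Set α) ⊆ Z}, (f F : Set α)
  let Y : ℕ → Set α := fun n => step^[n] X
  have hsucc : ∀ n, Y (n + 1) = step (Y n) := fun n => Function.iterate_succ_apply' step n X
  have hmono : Monotone Y := monotone_nat_of_le_succ fun n => by
    rw [hsucc]; exact Set.subset_union_left
  have hcount : ∀ n, (Y n).Countable := fun n => by
    induction n with
    | zero => exact hX
    | succ n ih =>
      rw [hsucc]
      exact ih.union ((countable_setOf_finset_subset ih).biUnion fun F _ =>
        (f F).countable_toSet)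
  refine ⟨⋃ n, Y n, Set.subset_iUnion Y 0, Set.countable_iUnion hcount, fun F hF => ?_⟩
  obtain ⟨n, hn⟩ := hmono.directed_le.exists_mem_subset_of_finset_subset_biUnion hF
  refine Set.Subset.trans ?_ (Set.subset_iUnion Y (n + 1))
  rw [hsucc]
  exact (Set.subset_biUnion_of_mem (u := fun F : Finset α => (f F : Set α)) hn).trans
    Set.subset_union_right

/-! ### Directed unions and countable presentations -/

section
variable {R : Type u} [Ring R] {C N M : Type u} [AddCommGroup C] [Module R C]
  [AddCommGroup N] [Module R N] [AddCommGroup M] [Module R M]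

/-- Strict stationarity along `u` holds if every finite subset of the domain lies in the range of
some `j` such that strict stationarity holds along `u ∘ j`. -/
theorem IsStrictStationaryAlong.of_finset {u : N →ₗ[R] M}
    (h : ∀ X : Finset N, ∃ (K : Type u) (_ : AddCommGroup K) (_ : Module R K) (j : K →ₗ[R] N),
      (X : Set N) ⊆ Set.range j ∧ IsStrictStationaryAlong C (u ∘ₗ j)) :
    IsStrictStationaryAlong C u := by
  classical
  intro X
  obtain ⟨K, _, _, j, hj, hK⟩ := h X
  choose! y hy using hj
  obtain ⟨S, hS, hψ⟩ := hK (X.image y)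
  refine ⟨S.image (Finsupp.mapDomain j), fun s hs => ?_, fun c hc => ?_⟩
  · obtain ⟨t, ht, rfl⟩ := Finset.mem_image.1 hs
    rw [linearCombination_id_mapDomain, linearCombination_linearMap, hS t ht, map_zero]
  · obtain ⟨ψ, h⟩ := hψ (c ∘ j) fun s hs => by
      have := hc _ (Finset.mem_image_of_mem _ hs)
      rwa [Finsupp.linearCombination_mapDomain] at this
    refine ⟨ψ, fun x hx => ?_⟩
    have := h _ (Finset.mem_image_of_mem _ hx)
    simpa [hy hx] using this

/-- A finite subset of a directed union lies in a single member. The test maps `ψ` are defined on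
all of `M`, so nothing has to be extended from that member. -/
theorem IsStrictStationaryAlong.iSup {ι : Type*} [Nonempty ι] {K : ι → Submodule R M}
    (hd : Directed (· ≤ ·) K) (hK : ∀ i, IsStrictStationaryAlong C (K i).subtype) :
    IsStrictStationaryAlong C (⨆ i, K i).subtype := by
  classical
  refine IsStrictStationaryAlong.of_finset fun X => ?_
  obtain ⟨i, hi⟩ := Directed.exists_mem_subset_of_finset_subset_biUnion
    (f := fun i => (K i : Set M)) (s := X.image (↑)) hd (by
      rw [← Submodule.coe_iSup_of_directed _ hd]
      intro x hx
      obtain ⟨y, -, rfl⟩ := Finset.mem_image.1 hx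
      exact y.2)
  exact ⟨K i, inferInstance, inferInstance, Submodule.inclusion (le_iSup K i),
    fun x hx => ⟨⟨x, hi (Finset.mem_image_of_mem _ hx)⟩, rfl⟩, hK i⟩

theorem IsStrictStationaryAlong.sSup {𝓝 : Set (Submodule R M)} (hne : 𝓝.Nonempty)
    (hd : DirectedOn (· ≤ ·) 𝓝) (h : ∀ K ∈ 𝓝, IsStrictStationaryAlong C K.subtype) :
    IsStrictStationaryAlong C (sSup 𝓝).subtype := by
  have := hne.to_subtype
  rw [sSup_eq_iSup']
  exact IsStrictStationaryAlong.iSup hd.directed_val fun K => h K.1 K.2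

/-- The linear relations between the elements of `Y`. -/
noncomputable def relationModule (R : Type u) [Ring R] {M : Type u} [AddCommGroup M] [Module R M]
    (Y : Set M) : Submodule R (M →₀ R) :=
  LinearMap.ker (Finsupp.linearCombination R (id : M → M)) ⊓ Finsupp.supported R R Y

/-- The relations between the elements of `Y` are countably generated. -/
def IsCountablyRelated (R : Type u) [Ring R] {M : Type u} [AddCommGroup M] [Module R M]
    (Y : Set M) : Prop :=
  ∃ T : Set (M →₀ R), T.Countable ∧ Submodule.span R T = relationModule R Y

theorem exists_supported_of_mem_span {Y : Set M} {x : M} (hx : x ∈ Submodule.span R Y) :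
    ∃ a ∈ Finsupp.supported R R Y, Finsupp.linearCombination R id a = x := by
  rw [← Set.image_id Y, Finsupp.mem_span_image_iff_linearCombination] at hx
  exact hx

/-- Countable generation of the relations does not depend on the countable generating set. -/
theorem IsCountablyRelated.of_span_eq {Y Z : Set M} (hY : IsCountablyRelated R Y)
    (hZ : Z.Countable) (h : Submodule.span R Y = Submodule.span R Z) :
    IsCountablyRelated R Z := by
  obtain ⟨T, hT, hTY⟩ := hY
  have ha : ∀ y : M, ∃ a : M →₀ R, y ∈ Y → a ∈ Finsupp.supported R R Z ∧
      Finsupp.linearCombination R id a = y := fun y => by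
    by_cases hy : y ∈ Y
    · obtain ⟨a, h1, h2⟩ := exists_supported_of_mem_span (h.le (Submodule.subset_span hy))
      exact ⟨a, fun _ => ⟨h1, h2⟩⟩
    · exact ⟨0, fun h => absurd h hy⟩
  have hb : ∀ z : M, ∃ b : M →₀ R, z ∈ Z → b ∈ Finsupp.supported R R Y ∧
      Finsupp.linearCombination R id b = z := fun z => by
    by_cases hz : z ∈ Z
    · obtain ⟨b, h1, h2⟩ := exists_supported_of_mem_span (h.ge (Submodule.subset_span hz))
      exact ⟨b, fun _ => ⟨h1, h2⟩⟩
    · exact ⟨0, fun h => absurd h hz⟩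
  choose a ha using ha
  choose b hb using hb
  have hA : ∀ x ∈ Finsupp.supported R R Y,
      Finsupp.linearCombination R a x ∈ Finsupp.supported R R Z ∧
      Finsupp.linearCombination R id (Finsupp.linearCombination R a x) =
        Finsupp.linearCombination R id x := fun x hx => by
    constructor
    · rw [Finsupp.linearCombination_apply]
      exact Submodule.sum_mem _ fun y hy => Submodule.smul_mem _ _ (ha y (hx hy)).1
    · rw [Finsupp.apply_linearCombination, Finsupp.linearCombination_apply,
        Finsupp.linearCombination_apply]
      exact Finsupp.sum_congr fun y hy => by simp [(ha y (hx hy)).2]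
  have hB : ∀ x ∈ Finsupp.supported R R Z,
      Finsupp.linearCombination R b x ∈ Finsupp.supported R R Y ∧
      Finsupp.linearCombination R id (Finsupp.linearCombination R b x) =
        Finsupp.linearCombination R id x := fun x hx => by
    constructor
    · rw [Finsupp.linearCombination_apply]
      exact Submodule.sum_mem _ fun y hy => Submodule.smul_mem _ _ (hb y (hx hy)).1
    · rw [Finsupp.apply_linearCombination, Finsupp.linearCombination_apply,
        Finsupp.linearCombination_apply]
      exact Finsupp.sum_congr fun y hy => by simp [(hb y (hx hy)).2]
  -- `d z` records that rewriting `z` over `Y` by `b` and back over `Z` by `a` does not change its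
  -- value. A relation over `Z` is a combination of these plus the rewriting of a relation over `Y`.
  let d : M → (M →₀ R) := fun z => Finsupp.single z 1 - Finsupp.linearCombination R a (b z)
  refine ⟨Finsupp.linearCombination R a '' T ∪ d '' Z, (hT.image _).union (hZ.image _),
    le_antisymm (Submodule.span_le.2 ?_) fun z hz => ?_⟩
  · rintro _ (⟨t, ht, rfl⟩ | ⟨z, hz, rfl⟩)
    · have ht' : t ∈ relationModule R Y := hTY ▸ Submodule.subset_span ht
      exact ⟨(hA t ht'.2).2.trans ht'.1, (hA t ht'.2).1⟩
    · refine ⟨?_, Submodule.sub_mem _ (Finsupp.single_mem_supported R 1 hz)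
        (hA _ (hb z hz).1).1⟩
      simp [d, (hA _ (hb z hz).1).2, (hb z hz).2]
  · have h1 : z = Finsupp.linearCombination R d z +
        Finsupp.linearCombination R a (Finsupp.linearCombination R b z) := by
      have : Finsupp.linearCombination R d = LinearMap.id -
          Finsupp.linearCombination R a ∘ₗ Finsupp.linearCombination R b := by
        ext1 w
        ext1
        simp [d]
      rw [this]
      simp
    rw [h1]
    refine Submodule.add_mem _ ?_ ?_
    · rw [Finsupp.linearCombination_apply]
      exact Submodule.sum_mem _ fun y hy => Submodule.smul_mem _ _
        (Submodule.subset_span (Or.inr ⟨y, hz.2 hy, rfl⟩))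
    · have h2 : Finsupp.linearCombination R b z ∈ Submodule.span R T := by
        rw [hTY]
        exact ⟨(hB z hz.2).2.trans hz.1, (hB z hz.2).1⟩
      refine Submodule.span_mono Set.subset_union_left ?_
      rw [← Submodule.map_span]
      exact Submodule.mem_map_of_mem h2

/-- This moves generators and relations into the fixed modules `M` and `M →₀ R`, where different
submodules can be compared. -/
theorem isLTPresented_aleph_one_iff {K : Submodule R M} : IsLTPresented R (Cardinal.aleph 1) K ↔
    ∃ Y : Set M, Y.Countable ∧ Submodule.span R Y = K ∧ IsCountablyRelated R Y := by
  have key : ∀ S : Set K, (LinearMap.ker (Finsupp.linearCombination R ((↑) : S → K))).map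
      (Finsupp.lmapDomain R R fun s : S => (s : M)) = relationModule R ((↑) '' S : Set M) := by
    intro S
    have h1 : LinearMap.ker (Finsupp.linearCombination R ((↑) : S → K)) =
        (LinearMap.ker (Finsupp.linearCombination R (id : M → M))).comap
          (Finsupp.lmapDomain R R fun s : S => (s : M)) := by
      ext x
      rw [Submodule.mem_comap, LinearMap.mem_ker, LinearMap.mem_ker, Finsupp.lmapDomain_apply,
        linearCombination_id_mapDomain, ← Submodule.coe_eq_zero, ← Submodule.subtype_apply,
        Finsupp.apply_linearCombination]
      rfl
    rw [h1, Submodule.map_comap_eq, inf_comm, LinearMap.range_eq_map, ← Finsupp.supported_univ,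
      Finsupp.lmapDomain_supported, relationModule]
    congr 2
    ext
    simp
  have hinj : ∀ S : Set K, Function.Injective (Finsupp.lmapDomain R R fun s : S => (s : M)) :=
    fun S => Finsupp.mapDomain_injective (Subtype.val_injective.comp Subtype.val_injective)
  constructor
  · rintro ⟨S, hS, hSK, T, hT, hTS⟩
    rw [Cardinal.mk_lt_aleph_one_iff] at hS hT
    refine ⟨(↑) '' S, hS.image _, ?_, Finsupp.lmapDomain R R (fun s : S => (s : M)) '' T,
      hT.image _, ?_⟩
    · rw [← Submodule.coe_subtype, ← Submodule.map_span, hSK, Submodule.map_subtype_top]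
    · rw [← Submodule.map_span, hTS, key]
  · rintro ⟨Y, hY, rfl, T, hT, hTY⟩
    let S : Set (Submodule.span R Y) := (↑) ⁻¹' Y
    have hSY : ((↑) '' S : Set M) = Y := by
      exact Set.image_preimage_eq_of_subset fun y hy => ⟨⟨y, Submodule.subset_span hy⟩, rfl⟩
    refine ⟨S, ?_, Submodule.span_span_coe_preimage,
      Finsupp.lmapDomain R R (fun s : S => (s : M)) ⁻¹' T, ?_, ?_⟩
    · rw [Cardinal.mk_lt_aleph_one_iff]
      exact hY.preimage Subtype.val_injective
    · rw [Cardinal.mk_lt_aleph_one_iff]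
      exact hT.preimage (hinj S)
    · refine Submodule.map_injective_of_injective (hinj S) ?_
      rw [key, hSY, Submodule.map_span, Set.image_preimage_eq_of_subset, hTY]
      intro t ht
      have ht' : t ∈ relationModule R ((↑) '' S : Set M) := by
        rw [hSY, ← hTY]
        exact Submodule.subset_span ht
      rw [← key] at ht'
      obtain ⟨x, -, hx⟩ := ht'
      exact ⟨x, hx⟩

/-- Directed unions of countably many countably presented submodules are countably presented. -/
theorem IsLTPresented.iSup_of_directed {ι : Type*} [Countable ι] [Nonempty ι]
    {K : ι → Submodule R M} (hd : Directed (· ≤ ·) K)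
    (hK : ∀ i, IsLTPresented R (Cardinal.aleph 1) (K i)) :
    IsLTPresented R (Cardinal.aleph 1) (⨆ i, K i : Submodule R M) := by
  simp only [isLTPresented_aleph_one_iff] at hK ⊢
  choose Y hY hYK hr using hK
  have hc : (⋃ i, Y i).Countable := Set.countable_iUnion hY
  -- Each `K i` is given all the generators it contains: a relation over the whole union has finite
  -- support, which lies in one `K i`, and is then a relation over that larger set.
  have hspan : ∀ i, Submodule.span R (Y i) = Submodule.span R ((⋃ i, Y i) ∩ K i) := fun i => by
    refine le_antisymm (Submodule.span_mono (Set.subset_inter (Set.subset_iUnion Y i) ?_)) ?_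
    · rw [← hYK i]; exact Submodule.subset_span
    · rw [hYK i]; exact Submodule.span_le.2 Set.inter_subset_right
  choose T hT hTY using fun i =>
    (hr i).of_span_eq (hc.mono (Set.inter_subset_left (t := (K i : Set M)))) (hspan i)
  refine ⟨⋃ i, Y i, hc, ?_, ⋃ i, T i, Set.countable_iUnion hT, ?_⟩
  · rw [Submodule.span_iUnion]
    simp only [hYK]
  · refine le_antisymm (Submodule.span_le.2 (Set.iUnion_subset fun i t ht => ?_)) fun y hy => ?_
    · have : t ∈ relationModule R _ := (hTY i).le (Submodule.subset_span ht)
      exact ⟨this.1, Finsupp.supported_mono Set.inter_subset_left this.2⟩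
    · obtain ⟨i, hi⟩ := Directed.exists_mem_subset_of_finset_subset_biUnion
        (f := fun i => (K i : Set M)) (s := y.support) hd (by
          refine hy.2.trans (Set.iUnion_mono fun i => ?_)
          rw [← hYK i]
          exact Submodule.subset_span)
      exact Submodule.span_mono (Set.subset_iUnion T i)
        ((hTY i).ge ⟨hy.1, Set.subset_inter hy.2 hi⟩)
end

/-! ### Cogenerators and the vanishing of Ext -/

open CategoryTheory in
/-- Modules that cogenerate separate elements from submodules that do not contain them. -/
theorem CategoryTheory.IsCoseparator.exists_linearMap {R : Type u} [Ring R] {C : Type u}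
    [AddCommGroup C] [Module R C] (hC : IsCoseparator (ModuleCat.of R C)) {A : Type u}
    [AddCommGroup A] [Module R A] (B : Submodule R A) {y : A} (hy : y ∉ B) :
    ∃ φ : A →ₗ[R] C, (∀ b ∈ B, φ b = 0) ∧ φ y ≠ 0 := by
  by_contra! hφ
  refine hy ((Submodule.Quotient.mk_eq_zero B).1 ?_)
  have := hC.def (ModuleCat.ofHom (LinearMap.toSpanSingleton R (A ⧸ B) (B.mkQ y))) 0 fun h => by
    ext
    have := hφ (h.hom ∘ₗ B.mkQ) fun b hb => by
      simp [(Submodule.Quotient.mk_eq_zero B).2 hb]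
    simpa using this
  simpa using congrArg (fun f => f.hom (1 : R)) this

open CategoryTheory Abelian in
/-- If all maps `K → C` extend to `M` and `Ext¹(M, C)` vanishes, so does `Ext¹(M / K, C)`. -/
theorem subsingleton_ext_quotient {R : Type u} [Ring R] {C M : Type u} [AddCommGroup C]
    [Module R C] [AddCommGroup M] [Module R M] (K : Submodule R M)
    (hK : ∀ φ : K →ₗ[R] C, ∃ ψ : M →ₗ[R] C, ψ ∘ₗ K.subtype = φ)
    (hM : Subsingleton (Ext (ModuleCat.of R M) (ModuleCat.of R C) 1)) :
    Subsingleton (Ext (ModuleCat.of R (M ⧸ K)) (ModuleCat.of R C) 1) := by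
  let S : ShortComplex (ModuleCat.{u} R) :=
    ShortComplex.mk (ModuleCat.ofHom K.subtype) (ModuleCat.ofHom K.mkQ) (by ext; simp)
  have hS : S.ShortExact :=
    { exact := (ShortComplex.ShortExact.moduleCat_exact_iff_function_exact S).2 <|
        LinearMap.exact_subtype_mkQ K
      mono_f := (ModuleCat.mono_iff_injective _).2 K.subtype_injective
      epi_g := (ModuleCat.epi_iff_surjective _).2 K.mkQ_surjective }
  refine subsingleton_of_forall_eq 0 fun x => ?_
  -- The class dies in `Ext¹(M, C)`, so it comes from a map `K → C`; as that map extends to `M`, the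
  -- connecting map kills it.
  obtain ⟨y, rfl⟩ := Ext.contravariant_sequence_exact₃ hS _ x (Subsingleton.elim _ _)
    (n₀ := 0) rfl
  obtain ⟨φ, rfl⟩ := (Ext.mk₀_bijective _ _).2 y
  obtain ⟨ψ, hψ⟩ := hK φ.hom
  have : φ = S.f ≫ ModuleCat.ofHom ψ := by
    ext x
    exact (LinearMap.congr_fun hψ x).symm
  rw [this, ← Ext.mk₀_comp_mk₀, hS.extClass_comp_assoc]

/-! ### Countably presented strict stationary submodules -/

section
variable {R : Type u} [Ring R] {C M : Type u} [AddCommGroup C] [Module R C]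
  [AddCommGroup M] [Module R M]

/-- Strict stationarity along the inclusion of the span of `Y` can be tested on finite subsets
of `Y`. -/
theorem IsStrictStationaryAlong.span_subtype {Y : Set M}
    (h : ∀ X : Finset M, (X : Set M) ⊆ Y → ∃ S : Finset (M →₀ R),
      (∀ s ∈ S, s ∈ relationModule R Y) ∧
        ∀ c : M → C, (∀ s ∈ S, Finsupp.linearCombination R c s = 0) →
          ∃ ψ : M →ₗ[R] C, ∀ x ∈ X, ψ x = c x) :
    IsStrictStationaryAlong C (Submodule.span R Y).subtype := by
  classical
  intro X
  have ha : ∀ x : Submodule.span R Y, ∃ a ∈ Finsupp.supported R R Y,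
      Finsupp.linearCombination R id a = (x : M) := fun x => exists_supported_of_mem_span x.2
  choose a haY ha using ha
  obtain ⟨S, hS, hψ⟩ := h (X.biUnion fun x => (a x).support) fun y hy => by
    obtain ⟨x, -, hx⟩ := Finset.mem_biUnion.1 hy
    exact haY x hx
  let r : (M →₀ R) →ₗ[R] (Submodule.span R Y →₀ R) :=
    Finsupp.lcomapDomain Subtype.val Subtype.val_injective
  have hr : ∀ t ∈ Finsupp.supported R R Y, ((r t).mapDomain Subtype.val : M →₀ R) = t :=
    fun t ht => Finsupp.mapDomain_comapDomain _ Subtype.val_injective _ fun y hy =>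
      ⟨⟨y, Submodule.subset_span (ht hy)⟩, rfl⟩
  have hrc : ∀ (c : M → C) (t : M →₀ R), t ∈ Finsupp.supported R R Y →
      Finsupp.linearCombination R (fun x : Submodule.span R Y => c x) (r t) =
        Finsupp.linearCombination R c t := fun c t ht => by
    conv_rhs => rw [← hr t ht, Finsupp.linearCombination_mapDomain]
    rfl
  have hr0 : ∀ t ∈ Finsupp.supported R R Y,
      ((Finsupp.linearCombination R id (r t) : Submodule.span R Y) : M) =
      Finsupp.linearCombination R id t := fun t ht => by
    conv_rhs => rw [← hr t ht, linearCombination_id_mapDomain]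
    rw [← Submodule.subtype_apply, Finsupp.apply_linearCombination]
    rfl
  refine ⟨S.image r ∪ X.image (fun x => Finsupp.single x 1 - r (a x)), fun s hs => ?_,
    fun c hc => ?_⟩
  · rcases Finset.mem_union.1 hs with hs | hs <;> obtain ⟨t, ht, rfl⟩ := Finset.mem_image.1 hs
    · exact Subtype.ext ((hr0 t (hS t ht).2).trans (hS t ht).1)
    · rw [map_sub, Finsupp.linearCombination_single, one_smul, sub_eq_zero]
      exact Subtype.ext ((hr0 _ (haY t)).trans (ha t)).symm
  -- The hypothesis tests functions on `M`, so `c` is extended by zero.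
  · obtain ⟨c', hc'⟩ : ∃ c' : M → C, ∀ x : Submodule.span R Y, c' x = c x :=
      ⟨Function.extend Subtype.val c 0, fun x => Subtype.val_injective.extend_apply _ _ x⟩
    obtain rfl : (fun x : Submodule.span R Y => c' x) = c := funext hc'
    obtain ⟨ψ, h⟩ := hψ c' fun s hs => by
      rw [← hrc c' s (hS s hs).2]
      exact hc _ (Finset.mem_union_left _ (Finset.mem_image_of_mem _ hs))
    refine ⟨ψ, fun x hx => ?_⟩
    change ψ x = c' x
    have h1 := hc _ (Finset.mem_union_right _ (Finset.mem_image_of_mem _ hx))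
    rw [map_sub, Finsupp.linearCombination_single, one_smul, hrc c' _ (haY x), sub_eq_zero] at h1
    rw [h1, ← ha x, Finsupp.apply_linearCombination,
      Finsupp.linearCombination_apply, Finsupp.linearCombination_apply]
    exact Finsupp.sum_congr fun y hy => by
      simp [h y (Finset.mem_biUnion.2 ⟨x, hx, hy⟩)]

/-- If `C` cogenerates, each countable subset of a strict stationary module lies in a countably
presented submodule along whose inclusion strict stationarity holds. -/
theorem IsStrictStationaryAlong.exists_countable_superset
    (hcogen : CategoryTheory.IsCoseparator (ModuleCat.of R C))
    (hM : IsStrictStationaryAlong C (LinearMap.id : M →ₗ[R] M)) {X : Set M} (hX : X.Countable) :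
    ∃ K : Submodule R M, X ⊆ K ∧ IsLTPresented R (Cardinal.aleph 1) K ∧
      IsStrictStationaryAlong C K.subtype := by
  classical
  choose σ hσ hψ using hM
  obtain ⟨Y, hXY, hY, hclosed⟩ := hX.exists_closed_superset
    fun F => (σ F).biUnion Finsupp.support
  have hσY : ∀ F : Finset M, (F : Set M) ⊆ Y → ∀ s ∈ σ F, s ∈ relationModule R Y :=
    fun F hF s hs => ⟨hσ F s hs, Set.Subset.trans
      (Finset.coe_subset.2 (Finset.subset_biUnion_of_mem Finsupp.support hs)) (hclosed F hF)⟩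
  refine ⟨Submodule.span R Y, hXY.trans Submodule.subset_span,
    isLTPresented_aleph_one_iff.2 ⟨Y, hY, rfl, ⋃ F ∈ {F : Finset M | (F : Set M) ⊆ Y}, σ F,
      (countable_setOf_finset_subset hY).biUnion fun F _ => (σ F).countable_toSet,
      le_antisymm ?_ fun y hy => ?_⟩,
    IsStrictStationaryAlong.span_subtype fun F hF => ⟨σ F, hσY F hF, fun c hc => hψ F c hc⟩⟩
  · exact Submodule.span_le.2 (Set.iUnion₂_subset fun F hF s hs => hσY F hF s hs)
  · refine Submodule.span_mono (Set.subset_biUnion_of_mem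
      (u := fun F : Finset M => (σ F : Set (M →₀ R))) (show y.support ∈ _ from hy.2)) ?_
    by_contra hy'
    -- `φ` separates the relation `y` from the span of `σ y.support`. On the support of `y` its
    -- values agree with a linear `ψ : M → C`, so `φ y` is the value of `ψ` at the sum represented
    -- by `y`, which is zero.
    obtain ⟨φ, hφ, hφy⟩ := hcogen.exists_linearMap _ hy'
    have hlin : Finsupp.linearCombination R (fun x : M => φ (Finsupp.single x 1)) = φ := by
      ext x
      simp
    obtain ⟨ψ, h⟩ := hψ y.support (fun x => φ (Finsupp.single x 1)) fun s hs => by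
      rw [hlin]
      exact hφ s (Submodule.subset_span hs)
    refine hφy ?_
    have h1 : ψ (Finsupp.linearCombination R id y) = 0 := by rw [hy.1, map_zero]
    rw [← hlin, ← h1, Finsupp.apply_linearCombination, Finsupp.linearCombination_apply,
      Finsupp.linearCombination_apply]
    exact Finsupp.sum_congr fun x hx => by
      have := h x hx
      simp_all
end

theorem mainTheorem10 (R : Type u) [Ring R] (C M : Type u) [AddCommGroup C] [Module R C]
    [AddCommGroup M] [Module R M]
    (hC : IsPureInjective R C)
    (hcogen : CategoryTheory.IsCoseparator (ModuleCat.of R C))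
    (hM : IsStationaryModule R C M) :
    ∃ 𝓛 : Set (Submodule R M),
      IsDenseSystem R (Cardinal.aleph 1) M 𝓛 ∧
      (∀ N ∈ 𝓛, IsStrictStationaryModule R C N) ∧
      ∀ 𝓝 : Set (Submodule R M), 𝓝 ⊆ 𝓛 → 𝓝.Nonempty → DirectedOn (· ≤ ·) 𝓝 →
        (∀ φ : ↥(sSup 𝓝) →ₗ[R] C, ∃ ψ : M →ₗ[R] C, ψ ∘ₗ (sSup 𝓝).subtype = φ) ∧
        (Subsingleton (CategoryTheory.Abelian.Ext (ModuleCat.of R M) (ModuleCat.of R C) 1) →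
          Subsingleton (CategoryTheory.Abelian.Ext
            (ModuleCat.of R (M ⧸ sSup 𝓝)) (ModuleCat.of R C) 1)) := by
  -- Stationarity is required along the inclusion into `M`, since this gives the extension of maps
  -- from unions to `M`.
  refine ⟨{K | IsLTPresented R (Cardinal.aleph 1) K ∧ IsStrictStationaryAlong C K.subtype},
    ⟨fun K hK => hK.1, fun o ho ho' K hmono hK => ?_, fun X hX => ?_⟩,
    fun K hK => hK.2.isStrictStationaryModule, fun 𝓝 h𝓝 hne hd => ?_⟩
  · have : Nonempty (Set.Iio o) := ⟨⟨0, ho⟩⟩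
    have : Countable (Set.Iio o) := by
      rw [← Cardinal.mk_le_aleph0_iff, Cardinal.mk_Iio_ordinal, Cardinal.lift_le_aleph0,
        ← Order.lt_succ_iff, Cardinal.succ_aleph0]
      exact Cardinal.lt_ord.1 ho'
    exact ⟨IsLTPresented.iSup_of_directed hmono.directed_le fun i => (hK i).1,
      IsStrictStationaryAlong.iSup hmono.directed_le fun i => (hK i).2⟩
  · obtain ⟨K, hXK, hK⟩ := (hM.isStrictStationaryAlong hC).exists_countable_superset hcogen
      (Cardinal.mk_lt_aleph_one_iff.1 hX)
    exact ⟨K, hK, hXK⟩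
  · have hext := (IsStrictStationaryAlong.sSup hne hd fun K hK => (h𝓝 hK).2).exists_extension hC
    exact ⟨hext, subsingleton_ext_quotient _ hext⟩
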